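/- **Setting.** For a finite set $\mathcal S$ let $\mathcal P(\mathcal S)$ be the set of probability vectors on $\mathcal S$ and $\|p-q\|_1=\sum_{s\in\mathcal S}|p(s)-q(s)|$. Let $\mathcal X$ (states) and $\mathcal U$ (actions) be finite sets, $\gamma\in(0,1)$ a discount factor, $\tilde r:\mathcal X\times\mathcal P(\mathcal X)\times\mathcal U\times\mathcal P(\mathcal U)\to\mathbb R$ a reward and $P:\mathcal X\times\mathcal P(\mathcal X)\times\mathcal U\times\mathcal P(\mathcal U)\to\mathcal P(\mathcal X)$ a transition function. A policy is a sequence $\pi=(\pi_t)_{t\ge 0}$ of measurable maps $\pi_t:\mathcal P(\mathcal X)\to\{h:\mathcal X\to\mathcal P(\mathcal U)\}$; write $\pi_t(\mu,x)=\pi_t(\mu)(x)\in\mathcal P(\mathcal U)$. Let $\Pi$ be a class of policies. *Mean-field control (MFC).* For $\mu\in\mathcal P(\mathcal X)$ and $\pi\in\Pi$ put $$v^\pi(\mu)=\mathbb E\Big[\sum_{t=0}^\infty\gamma^t\,\tilde r(x_t,\mu_t,u_t,\nu_t)\Big],\qquad x_0\sim\mu,\quad u_t\sim\pi_t(\mu_t,x_t),\quad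 x_{t+1}\sim P(x_t,\mu_t,u_t,\nu_t),$$ where $\mu_t$ is the law of $x_t$ and $\nu_t=\sum_{x\in\mathcal X}\pi_t(\mu_t,x)\,\mu_t(x)$. A policy $\pi\in\Pi$ is $\epsilon$-optimal for (MFC) at $\mu$ if $v^\pi(\mu)\ge\sup_{\pi'\in\Pi}v^{\pi'}(\mu)-\epsilon$. *Cooperative $N$-agent problem (MARL).* For $N\ge1$ and an initial profile $(x^{1},\dots,x^{N})\in\mathcal X^N$ with empirical distribution $\mu^N(x)=\frac1N\sum_{j=1}^N 1(x^{j}=x)$ put $$u_N^\pi(\mu^N)=\frac1N\sum_{j=1}^N\mathbb E\Big[\sum_{t=0}^\infty\gamma^t\,\tilde r(x_t^{j,N},\mu_t^N,u_t^{j,N},\nu_t^N)\Big],\qquad x_0^{j,N}=x^j,$$ where $\mu_t^N$ and $\nu_t^N$ are the empirical distributions of the states and of the actions of the $N$ agents at time $t$; given the states at time $t$ the actions $u_t^{j,N}\sim\pi_t(\mu_t^N,x_t^{j,N})$, $1\le j\le N$, are independent, and given the states and actions up to time $t$ the next states $x_{t+1}^{j,N}\sim P(x_t^{j,N},\mu_t^N,u_t^{j,N},\nu_t^N)$,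 $1\le j\le N$, are independent. A policy $\pi\in\Pi$ is $\epsilon$-Pareto optimal for (MARL) from this initial profile if $u_N^\pi(\mu^N)\ge\sup_{\pi'\in\Pi}u_N^{\pi'}(\mu^N)-\epsilon$. **Theorem (Approximation).** Let $\tilde R,L_{\tilde r},L_P,L_\Pi>0$ and $\gamma\in(0,1)$ satisfy $\gamma(2L_P+1)(1+L_\Pi)<1$. Assume that for all $x\in\mathcal X$, $u\in\mathcal U$, $\mu_1,\mu_2\in\mathcal P(\mathcal X)$, $\nu_1,\nu_2\in\mathcal P(\mathcal U)$, all $\pi\in\Pi$ and $t\ge0$: 1. $|\tilde r(x,\mu_1,u,\nu_1)|\le\tilde R$ and $|\tilde r(x,\mu_1,u,\nu_1)-\tilde r(x,\mu_2,u,\nu_2)|\le L_{\tilde r}(\|\mu_1-\mu_2\|_1+\|\nu_1-\nu_2\|_1)$; 2. $\|P(x,\mu_1,u,\nu_1)-P(x,\mu_2,u,\nu_2)\|_1\le L_P(\|\mu_1-\mu_2\|_1+\|\nu_1-\nu_2\|_1)$; 3. $\|\pi_t(\mu_1,x)-\pi_t(\mu_2,x)\|_1\le L_\Pi\|\mu_1-\mu_2\|_1$.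 Then, with $C=K\,(\sqrt{|\mathcal X|}+\sqrt{|\mathcal U|})$, where $K\ge0$ depends only on $L_P,L_{\tilde r},L_\Pi,\tilde R,\gamma$, $$\sup_{\pi\in\Pi}\big|u_N^\pi(\mu^N)-v^\pi(\mu^N)\big|\le\frac{C}{\sqrt N}$$ for every $N\ge1$ and every initial profile $(x^1,\dots,x^N)\in\mathcal X^N$. Consequently, for every $\epsilon_1>0$ there is $D_{\epsilon_1}\in\mathbb N$ such that for all $N\ge D_{\epsilon_1}$, $N\ge 1$, all initial profiles in $\mathcal X^N$ and all $\epsilon_2\ge0$, every policy $\pi\in\Pi$ that is $\epsilon_2$-optimal for (MFC) at $\mu^N$ is $(\epsilon_1+\epsilon_2)$-Pareto optimal for (MARL) from that initial profile. -/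

import Mathlib

open MeasureTheory ProbabilityTheory

noncomputable section

namespace MeanField

/-- `𝒫(S)`: the probability vectors on a finite set `S`, with the topology and the Borel
σ-algebra inherited from `S → ℝ`. -/
abbrev Prob (S : Type*) [Fintype S] : Type _ := stdSimplex ℝ S

/-- The `ℓ¹` distance `‖p - q‖₁` on `𝒫(S)`. -/
def l1dist {S : Type*} [Fintype S] (p q : Prob S) : ℝ := ∑ s, |p s - q s|

/-- A probability vector, seen as a measure. -/
def Prob.law {S : Type*} [Fintype S] [MeasurableSpace S] (p : Prob S) : Measure S :=
  ∑ s, ENNReal.ofReal (p s) • Measure.dirac s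

instance {S : Type*} [Fintype S] [MeasurableSpace S] (p : Prob S) :
    IsProbabilityMeasure p.law := by
  constructor
  simp only [Prob.law, Measure.coe_finsetSum, Finset.sum_apply, Measure.smul_apply,
    measure_univ, smul_eq_mul, mul_one]
  rw [← ENNReal.ofReal_sum_of_nonneg (f := fun s => p s) fun s _ => p.2.1 s, show ∑ s, p s = 1 from p.2.2,
    ENNReal.ofReal_one]

open scoped Classical in
/-- The empirical distribution `s ↦ (1/N) ∑ⱼ 1(yⱼ = s)` of a profile `y ∈ S^N`, `N ≥ 1`. -/
def empirical {S : Type*} [Fintype S] {N : ℕ} [NeZero N] (y : Fin N → S) : Prob S :=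
  ⟨fun s => (∑ j, if y j = s then (1 : ℝ) else 0) / N, by
    constructor
    · intro s
      positivity
    · rw [← Finset.sum_div, Finset.sum_comm]
      simp [NeZero.ne N]⟩

section Paths

variable {A B : Type*} [MeasurableSpace A] [MeasurableSpace B]

/-- One step of a controlled chain: from `(aₜ, bₜ)` draw `aₜ₊₁ ∼ tr t (aₜ, bₜ)`, and then
`bₜ₊₁ ∼ act (t + 1) aₜ₊₁`. -/
def stepKernel (act : ℕ → Kernel A B) (tr : ℕ → Kernel (A × B) A) (t : ℕ) :
    Kernel (A × B) (A × B) :=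
  tr t ⊗ₖ (act (t + 1)).prodMkLeft (A × B)

instance (act : ℕ → Kernel A B) (tr : ℕ → Kernel (A × B) A) [∀ t, IsMarkovKernel (act t)]
    [∀ t, IsMarkovKernel (tr t)] (t : ℕ) : IsMarkovKernel (stepKernel act tr t) := by
  unfold stepKernel
  infer_instance

/-- The law on the path space `ℕ → A × B` of the controlled Markov chain `(aₜ, bₜ)` with
`a₀ ∼ m`, `bₜ ∼ act t aₜ`, `aₜ₊₁ ∼ tr t (aₜ, bₜ)`. -/
def pathLaw (m : Measure A) (act : ℕ → Kernel A B) (tr : ℕ → Kernel (A × B) A)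
    [∀ t, IsMarkovKernel (act t)] [∀ t, IsMarkovKernel (tr t)] : Measure (ℕ → A × B) :=
  Kernel.trajMeasure (X := fun _ => A × B) (m ⊗ₘ act 0) fun t =>
    (stepKernel act tr t).comap (fun h => h ⟨t, Finset.mem_Iic.2 le_rfl⟩)
      (measurable_pi_apply _)

theorem map_zero_pathLaw (m : Measure A) [IsProbabilityMeasure m] (act : ℕ → Kernel A B)
    (tr : ℕ → Kernel (A × B) A) [∀ t, IsMarkovKernel (act t)] [∀ t, IsMarkovKernel (tr t)] :
    (pathLaw m act tr).map (fun ω => ω 0) = m ⊗ₘ act 0 := by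
  have h0 : (fun ω : ℕ → A × B => ω 0) =
      (fun h : (i : Finset.Iic 0) → A × B => h ⟨0, Finset.mem_Iic.2 le_rfl⟩) ∘
        Preorder.frestrictLe (π := fun _ => A × B) 0 := rfl
  rw [h0, ← Measure.map_map (by fun_prop) (by fun_prop), pathLaw, Kernel.trajMeasure,
    Measure.map_comp _ _ (by fun_prop), Kernel.traj_map_frestrictLe, Kernel.partialTraj_self,
    Measure.id_comp, Measure.map_map (by fun_prop) (by fun_prop)]
  exact Measure.map_id

theorem map_succ_pathLaw (m : Measure A) [IsProbabilityMeasure m] (act : ℕ → Kernel A B)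
    (tr : ℕ → Kernel (A × B) A) [∀ t, IsMarkovKernel (act t)] [∀ t, IsMarkovKernel (tr t)]
    (t : ℕ) :
    (pathLaw m act tr).map (fun ω => ω (t + 1)) =
      stepKernel act tr t ∘ₘ (pathLaw m act tr).map (fun ω => ω t) := by
  have hev : Measurable fun h : (i : Finset.Iic t) → A × B => h ⟨t, Finset.mem_Iic.2 le_rfl⟩ :=
    measurable_pi_apply _
  have h0 : (fun ω : ℕ → A × B => ω t) =
      (fun h : (i : Finset.Iic t) → A × B => h ⟨t, Finset.mem_Iic.2 le_rfl⟩) ∘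
        Preorder.frestrictLe (π := fun _ => A × B) t := rfl
  have h1 : (fun ω : ℕ → A × B => ω (t + 1)) =
      Prod.snd ∘ fun ω => (Preorder.frestrictLe (π := fun _ => A × B) t ω, ω (t + 1)) := rfl
  rw [h1, ← Measure.map_map (by fun_prop) (by fun_prop), pathLaw,
    ← Kernel.map_frestrictLe_trajMeasure_compProd_eq_map_trajMeasure]
  change Measure.snd _ = _
  rw [Measure.snd_compProd, h0, ← Measure.map_map hev (by fun_prop),
    ← Measure.deterministic_comp_eq_map hev, Measure.comp_assoc,
    Kernel.comp_deterministic_eq_comap]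

end Paths

section Model

variable {X U : Type*} [Fintype X] [Fintype U]

variable (X U) in
/-- A reward `r̃(x, μ, u, ν)`. -/
abbrev Reward : Type _ := X → Prob X → U → Prob U → ℝ

variable (X U) in
/-- A transition function `P(x, μ, u, ν) ∈ 𝒫(X)`. -/
abbrev Transition : Type _ := X → Prob X → U → Prob U → Prob X

variable (X U) in
/-- A policy `π = (πₜ)ₜ`, where `πₜ` maps `μ ∈ 𝒫(X)` to a local policy `πₜ(μ) : X → 𝒫(U)`. -/
abbrev Policy : Type _ := ℕ → Prob X → X → Prob U

/-- Admissible policies: every `πₜ` is measurable. -/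
def Policy.Admissible (π : Policy X U) : Prop := ∀ t, Measurable (π t)

/-- `‖πₜ(μ₁, x) - πₜ(μ₂, x)‖₁ ≤ L ‖μ₁ - μ₂‖₁` for all `t`, `x`, `μ₁`, `μ₂`. -/
def Policy.LipschitzBound (π : Policy X U) (L : ℝ) : Prop :=
  ∀ t x μ₁ μ₂, l1dist (π t μ₁ x) (π t μ₂ x) ≤ L * l1dist μ₁ μ₂

/-- The reward is bounded by `R` and `L`-Lipschitz in `(μ, ν)`. -/
def Reward.Regular (r : Reward X U) (R L : ℝ) : Prop :=
  (∀ x μ u ν, |r x μ u ν| ≤ R) ∧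
    ∀ x u μ₁ μ₂ ν₁ ν₂, |r x μ₁ u ν₁ - r x μ₂ u ν₂| ≤ L * (l1dist μ₁ μ₂ + l1dist ν₁ ν₂)

/-- The transition function is `L`-Lipschitz in `(μ, ν)`. -/
def Transition.LipschitzBound (P : Transition X U) (L : ℝ) : Prop :=
  ∀ x u μ₁ μ₂ ν₁ ν₂,
    l1dist (P x μ₁ u ν₁) (P x μ₂ u ν₂) ≤ L * (l1dist μ₁ μ₂ + l1dist ν₁ ν₂)

/-- `ν(μ, h) = ∑ₓ h(x)(·) μ(x)`: the law of `u` when `x ∼ μ` and `u ∼ h(x)`. -/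
def actionDist (μ : Prob X) (h : X → Prob U) : Prob U :=
  ⟨fun u => ∑ x, h x u * μ x, by
    constructor
    · intro u
      exact Finset.sum_nonneg fun x _ => mul_nonneg ((h x).2.1 u) (μ.2.1 x)
    · rw [Finset.sum_comm]
      simp only [← Finset.sum_mul]
      simp only [show ∀ x, ∑ u, h x u = 1 from fun x => (h x).2.2, one_mul]
      exact μ.2.2⟩

/-- `Φ(μ, h) = ∑ₓ ∑ᵤ P(x, μ, u, ν(μ, h)) μ(x) h(x)(u)`: the law of the next state when
`x ∼ μ`, `u ∼ h(x)` and the next state is drawn from `P(x, μ, u, ν(μ, h))`. -/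
def nextStateDist (P : Transition X U) (μ : Prob X) (h : X → Prob U) : Prob X :=
  ⟨fun y => ∑ x, ∑ u, P x μ u (actionDist μ h) y * μ x * h x u, by
    constructor
    · intro y
      exact Finset.sum_nonneg fun x _ => Finset.sum_nonneg fun u _ =>
        mul_nonneg (mul_nonneg ((P x μ u (actionDist μ h)).2.1 y) (μ.2.1 x)) ((h x).2.1 u)
    · rw [Finset.sum_comm]
      have h1 : ∀ x, ∑ y, ∑ u, P x μ u (actionDist μ h) y * μ x * h x u = μ x := by
        intro x
        rw [Finset.sum_comm]
        simp only [← Finset.sum_mul]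
        simp only [show ∀ u, ∑ y, P x μ u (actionDist μ h) y = 1 from
          fun u => (P x μ u (actionDist μ h)).2.2, one_mul]
        rw [← Finset.mul_sum, show ∑ u, h x u = 1 from (h x).2.2, mul_one]
      simp only [h1]
      exact μ.2.2⟩

/-- The population state distribution `μₜ` of the mean-field problem, `μ₀ = μ`. It is the law of
the representative agent's state `xₜ`: see `map_state_mfcLaw` below. -/
def stateFlow (P : Transition X U) (π : Policy X U) (μ : Prob X) : ℕ → Prob X
  | 0 => μ
  | t + 1 => nextStateDist P (stateFlow P π μ t) (π t (stateFlow P π μ t))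

/-- The population action distribution `νₜ = ∑ₓ πₜ(μₜ, x)(·) μₜ(x)`. -/
def actionFlow (P : Transition X U) (π : Policy X U) (μ : Prob X) (t : ℕ) : Prob U :=
  actionDist (stateFlow P π μ t) (π t (stateFlow P π μ t))

variable [MeasurableSpace X] [DiscreteMeasurableSpace X]
  [MeasurableSpace U] [DiscreteMeasurableSpace U]

/-! ### The mean-field control problem -/

/-- `uₜ ∼ πₜ(μₜ, xₜ)`. -/
def mfcAct (P : Transition X U) (π : Policy X U) (μ : Prob X) (t : ℕ) : Kernel X U :=
  Kernel.ofFunOfCountable fun x => (π t (stateFlow P π μ t) x).law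

/-- `xₜ₊₁ ∼ P(xₜ, μₜ, uₜ, νₜ)`. -/
def mfcTrans (P : Transition X U) (π : Policy X U) (μ : Prob X) (t : ℕ) : Kernel (X × U) X :=
  Kernel.ofFunOfCountable fun z =>
    (P z.1 (stateFlow P π μ t) z.2 (actionFlow P π μ t)).law

instance (P : Transition X U) (π : Policy X U) (μ : Prob X) (t : ℕ) :
    IsMarkovKernel (mfcAct P π μ t) :=
  ⟨fun x => inferInstanceAs (IsProbabilityMeasure (π t (stateFlow P π μ t) x).law)⟩

instance (P : Transition X U) (π : Policy X U) (μ : Prob X) (t : ℕ) :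
    IsMarkovKernel (mfcTrans P π μ t) :=
  ⟨fun z => inferInstanceAs
    (IsProbabilityMeasure (P z.1 (stateFlow P π μ t) z.2 (actionFlow P π μ t)).law)⟩

/-- The law of the path `(xₜ, uₜ)ₜ` of the representative agent, with `x₀ ∼ μ`. -/
def mfcLaw (P : Transition X U) (π : Policy X U) (μ : Prob X) : Measure (ℕ → X × U) :=
  pathLaw μ.law (mfcAct P π μ) (mfcTrans P π μ)

/-- The consistency condition of the mean-field problem: `μₜ` is the law of `xₜ`. -/
theorem map_state_mfcLaw (P : Transition X U) (π : Policy X U) (μ : Prob X) (t : ℕ) :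
    (mfcLaw P π μ).map (fun ω => (ω t).1) = (stateFlow P π μ t).law := by
  have key : (mfcLaw P π μ).map (fun ω => ω t) = (stateFlow P π μ t).law ⊗ₘ mfcAct P π μ t := by
    induction t with
    | zero => exact map_zero_pathLaw _ _ _
    | succ t ih =>
      have h1 := map_succ_pathLaw μ.law (mfcAct P π μ) (mfcTrans P π μ) t
      rw [← mfcLaw, ih] at h1
      have hX : ∀ (p : Prob X) (x : X), 0 ≤ p x := fun p x => p.2.1 x
      have hU : ∀ (p : Prob U) (u : U), 0 ≤ p u := fun p u => p.2.1 u
      have hn : ∀ y, ENNReal.ofReal (stateFlow P π μ (t + 1) y) =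
          ∑ x, ∑ u, ENNReal.ofReal (P x (stateFlow P π μ t) u (actionFlow P π μ t) y) *
            ENNReal.ofReal (stateFlow P π μ t x) *
            ENNReal.ofReal (π t (stateFlow P π μ t) x u) := by
        intro y
        have hy : stateFlow P π μ (t + 1) y =
            ∑ x, ∑ u, P x (stateFlow P π μ t) u (actionFlow P π μ t) y *
              stateFlow P π μ t x * π t (stateFlow P π μ t) x u := rfl
        have hpos : ∀ x u, 0 ≤ P x (stateFlow P π μ t) u (actionFlow P π μ t) y *
              stateFlow P π μ t x * π t (stateFlow P π μ t) x u :=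
          fun x u => mul_nonneg (mul_nonneg (hX _ _) (hX _ _)) (hU _ _)
        rw [hy, ENNReal.ofReal_sum_of_nonneg fun x _ => Finset.sum_nonneg fun u _ => hpos x u]
        refine Finset.sum_congr rfl fun x _ => ?_
        rw [ENNReal.ofReal_sum_of_nonneg fun u _ => hpos x u]
        refine Finset.sum_congr rfl fun u _ => ?_
        rw [ENNReal.ofReal_mul (mul_nonneg (hX _ _) (hX _ _)), ENNReal.ofReal_mul (hX _ _)]
      have h2 : mfcTrans P π μ t ∘ₘ ((stateFlow P π μ t).law ⊗ₘ mfcAct P π μ t) =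
          (stateFlow P π μ (t + 1)).law := by
        refine Measure.ext fun s hs => ?_
        rw [Measure.bind_apply hs (Kernel.aemeasurable _),
          Measure.lintegral_compProd (Kernel.measurable_coe _ hs)]
        simp only [Prob.law, mfcAct, mfcTrans, Kernel.ofFunOfCountable, Kernel.coe_mk,
          lintegral_finsetSum_measure, lintegral_smul_measure, lintegral_dirac,
          Measure.coe_finsetSum, Finset.sum_apply, Measure.smul_apply, smul_eq_mul]
        simp only [hn, Finset.mul_sum, Finset.sum_mul]
        refine Eq.trans ?_ Finset.sum_comm
        refine Finset.sum_congr rfl fun x _ => ?_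
        refine Eq.trans ?_ Finset.sum_comm
        refine Finset.sum_congr rfl fun u _ => Finset.sum_congr rfl fun y _ => ?_
        ring
      rw [h1, ← h2, stepKernel, Kernel.compProd_prodMkLeft_eq_comp, ← Measure.comp_assoc,
        Measure.compProd_eq_comp_prod (_ ∘ₘ _)]
  have h0 : (fun ω : ℕ → X × U => (ω t).1) = Prod.fst ∘ fun ω => ω t := rfl
  rw [h0, ← Measure.map_map (by fun_prop) (by fun_prop), key]
  exact Measure.fst_compProd _ _

/-- `v^π(μ) = 𝔼[∑ₜ γᵗ r̃(xₜ, μₜ, uₜ, νₜ) | x₀ ∼ μ]`. -/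
def mfcValue (γ : ℝ) (r : Reward X U) (P : Transition X U) (π : Policy X U) (μ : Prob X) : ℝ :=
  ∫ ω, ∑' t, γ ^ t * r (ω t).1 (stateFlow P π μ t) (ω t).2 (actionFlow P π μ t) ∂mfcLaw P π μ

/-- `π ∈ Π` is `ε`-optimal at `μ` for the mean-field problem over the policy class `Π`:
`v^π(μ) ≥ sup_{π' ∈ Π} v^{π'}(μ) - ε`. -/
def IsEpsOptimal (γ : ℝ) (r : Reward X U) (P : Transition X U) (Pol : Set (Policy X U))
    (ε : ℝ) (π : Policy X U) (μ : Prob X) : Prop :=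
  π ∈ Pol ∧ ∀ π' ∈ Pol, mfcValue γ r P π' μ - ε ≤ mfcValue γ r P π μ

/-! ### The cooperative `N`-agent problem -/

variable {N : ℕ} [NeZero N]

/-- Given the state profile at time `t`, the agents draw their actions independently,
`uₜʲ ∼ πₜ(μₜᴺ, xₜʲ)`. -/
def marlAct (π : Policy X U) (t : ℕ) : Kernel (Fin N → X) (Fin N → U) :=
  Kernel.ofFunOfCountable fun x => Measure.pi fun j => (π t (empirical x) (x j)).law

/-- Given the state and action profiles at time `t`, the next states are independent,
`xₜ₊₁ʲ ∼ P(xₜʲ, μₜᴺ, uₜʲ, νₜᴺ)`. -/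
def marlTrans (P : Transition X U) : Kernel ((Fin N → X) × (Fin N → U)) (Fin N → X) :=
  Kernel.ofFunOfCountable fun z =>
    Measure.pi fun j => (P (z.1 j) (empirical z.1) (z.2 j) (empirical z.2)).law

instance (π : Policy X U) (t : ℕ) : IsMarkovKernel (marlAct (N := N) π t) :=
  ⟨fun x => inferInstanceAs
    (IsProbabilityMeasure (Measure.pi fun j => (π t (empirical x) (x j)).law))⟩

instance (P : Transition X U) : IsMarkovKernel (marlTrans (N := N) P) :=
  ⟨fun z => inferInstanceAs (IsProbabilityMeasure
    (Measure.pi fun j => (P (z.1 j) (empirical z.1) (z.2 j) (empirical z.2)).law))⟩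

/-- The law of the path of state and action profiles of the `N` agents, started from the state
profile `x`. -/
def marlLaw (P : Transition X U) (π : Policy X U) (x : Fin N → X) :
    Measure (ℕ → (Fin N → X) × (Fin N → U)) :=
  pathLaw (Measure.dirac x) (marlAct π) fun _ => marlTrans P

/-- `u_N^π = (1/N) ∑ⱼ 𝔼[∑ₜ γᵗ r̃(xₜʲ, μₜᴺ, uₜʲ, νₜᴺ)]`, started from the state profile `x`. -/
def marlValue (γ : ℝ) (r : Reward X U) (P : Transition X U) (π : Policy X U)
    (x : Fin N → X) : ℝ :=
  (1 / N) * ∑ j, ∫ ω, ∑' t,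
    γ ^ t * r ((ω t).1 j) (empirical (ω t).1) ((ω t).2 j) (empirical (ω t).2) ∂marlLaw P π x

/-- `π ∈ Π` is `ε`-Pareto optimal for the `N`-agent problem started from the profile `x`, over the
policy class `Π`: `u_N^π ≥ sup_{π' ∈ Π} u_N^{π'} - ε`. -/
def IsEpsPareto (γ : ℝ) (r : Reward X U) (P : Transition X U) (Pol : Set (Policy X U))
    (ε : ℝ) (π : Policy X U) (x : Fin N → X) : Prop :=
  π ∈ Pol ∧ ∀ π' ∈ Pol, marlValue γ r P π' x - ε ≤ marlValue γ r P π x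

end Model

end MeanField

end

noncomputable section

namespace MeanField

section Simplex

variable {S Y : Type*} [Fintype S] [Fintype Y]

theorem Prob.nonneg (p : Prob S) (s : S) : 0 ≤ p s := p.2.1 s

theorem Prob.sum_eq_one (p : Prob S) : ∑ s, p s = 1 := p.2.2

theorem Prob.le_one (p : Prob S) (s : S) : p s ≤ 1 :=
  (Finset.single_le_sum (f := fun s => p s) (fun s _ => p.nonneg s) (Finset.mem_univ s)).trans_eq
    p.sum_eq_one

theorem l1dist_nonneg (p q : Prob S) : 0 ≤ l1dist p q :=
  Finset.sum_nonneg fun _ _ => abs_nonneg _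

theorem l1dist_self (p : Prob S) : l1dist p p = 0 := by simp [l1dist]

theorem l1dist_triangle (p q r : Prob S) : l1dist p r ≤ l1dist p q + l1dist q r := by
  unfold l1dist
  rw [← Finset.sum_add_distrib]
  exact Finset.sum_le_sum fun s _ => abs_sub_le _ _ _

theorem integral_law [MeasurableSpace S] [DiscreteMeasurableSpace S] (p : Prob S) (f : S → ℝ) :
    ∫ s, f s ∂p.law = ∑ s, p s * f s := by
  unfold Prob.law
  rw [integral_finsetSum_measure fun s _ => ?_]
  · refine Finset.sum_congr rfl fun s _ => ?_
    rw [integral_smul_measure, integral_dirac, ENNReal.toReal_ofReal (p.nonneg s), smul_eq_mul]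
  · exact (Integrable.of_finite (μ := Measure.dirac s)).smul_measure ENNReal.ofReal_ne_top

theorem sum_empirical_mul {N : ℕ} [NeZero N] (y : Fin N → S) (f : S → ℝ) :
    ∑ s, empirical y s * f s = (∑ j, f (y j)) / N := by
  classical
  have h : ∀ s, empirical y s = (∑ j, if y j = s then (1 : ℝ) else 0) / N := fun s => by
    change (∑ j, _) / (N : ℝ) = _
    congr!
  simp only [h, div_mul_eq_mul_div, ← Finset.sum_div, Finset.sum_mul]
  rw [Finset.sum_comm]
  simp

/-- The mean absolute deviation, summed over coordinates, of an average of `N` independent random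
probability vectors. -/
theorem integral_sum_abs_average_sub_le [MeasurableSpace S] [DiscreteMeasurableSpace S]
    {N : ℕ} [NeZero N] (p : Fin N → Prob S) (f : Fin N → S → Prob Y) :
    ∫ s, ∑ y, |(∑ j, f j (s j) y) / N - (∑ j, ∑ a, p j a * f j a y) / N|
        ∂Measure.pi (fun j => (p j).law) ≤ √(Fintype.card Y) / √N := by
  set M := Measure.pi (fun j => (p j).law) with hM
  have hN : (0 : ℝ) < N := by exact_mod_cast Nat.pos_of_ne_zero (NeZero.ne N)
  rw [integral_finsetSum _ fun y _ => Integrable.of_finite]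
  let Z : Y → (Fin N → S) → ℝ := fun y s => ∑ j, f j (s j) y
  have hmean : ∀ y, ∫ s, Z y s ∂M = ∑ j, ∑ a, p j a * f j a y := by
    intro y
    rw [integral_finsetSum _ fun y _ => Integrable.of_finite]
    refine Finset.sum_congr rfl fun j _ => ?_
    rw [← integral_law, hM]
    exact integral_comp_eval (μ := fun j => (p j).law) (f := fun a => f j a y)
      (Measurable.of_discrete.aestronglyMeasurable)
  have hvar : ∀ y, Var[Z y; M] ≤ ∑ j, ∑ a, p j a * f j a y := by
    intro y
    have h1 := variance_sum_pi (μ := fun j => (p j).law) (X := fun j a => (f j a y : ℝ))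
      (fun j => MemLp.of_discrete)
    have h2 : Z y = ∑ j, fun s => (f j (s j) y : ℝ) := by
      funext s; simp [Z, Finset.sum_apply]
    rw [h2, hM, h1]
    refine Finset.sum_le_sum fun j _ => ?_
    refine (variance_le_expectation_sq Measurable.of_discrete.aestronglyMeasurable).trans ?_
    rw [← integral_law]
    refine integral_mono Integrable.of_finite Integrable.of_finite fun a => ?_
    simp only [Pi.pow_apply]
    nlinarith [(f j a).nonneg y, (f j a).le_one y]
  have habs : ∀ y, ∫ s, |(∑ j, f j (s j) y) / N - (∑ j, ∑ a, p j a * f j a y) / N| ∂M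
      ≤ √(∑ j, ∑ a, p j a * f j a y) / N := by
    intro y
    rw [← hmean y]
    have h1 : ∀ s, |(∑ j, f j (s j) y) / N - (∫ s, Z y s ∂M) / N|
        = |Z y s - ∫ s, Z y s ∂M| / N := fun s => by
      rw [← sub_div, abs_div, abs_of_pos hN]
    simp only [h1]
    rw [integral_div]
    gcongr
    rw [hmean y]
    refine (Real.le_sqrt_of_sq_le ?_ : _ ≤ √(Var[Z y; M])).trans (Real.sqrt_le_sqrt (hvar y))
    have h3 := variance_nonneg (fun s => |Z y s - ∫ s, Z y s ∂M|) M
    rw [variance_eq_sub MemLp.of_discrete] at h3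
    rw [variance_eq_integral Measurable.of_discrete.aemeasurable]
    simpa [hmean y] using h3
  refine (Finset.sum_le_sum fun y _ => habs y).trans ?_
  rw [← Finset.sum_div]
  have htot : ∑ y, ∑ j, ∑ a, p j a * f j a y = N := by
    rw [Finset.sum_comm]
    have : ∀ j, ∑ y, ∑ a, p j a * f j a y = 1 := fun j => by
      rw [Finset.sum_comm]
      simp only [← Finset.mul_sum, Prob.sum_eq_one, mul_one]
    simp [this]
  have hpos : ∀ y, 0 ≤ ∑ j, ∑ a, p j a * f j a y := fun y =>
    Finset.sum_nonneg fun j _ => Finset.sum_nonneg fun a _ =>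
      mul_nonneg ((p j).nonneg a) ((f j a).nonneg y)
  have hcs : ∑ y, √(∑ j, ∑ a, p j a * f j a y) ≤ √(Fintype.card Y) * √N := by
    rw [← Real.sqrt_mul (by positivity)]
    refine Real.le_sqrt_of_sq_le ?_
    refine sq_sum_le_card_mul_sum_sq.trans ?_
    simp only [Real.sq_sqrt (hpos _), htot, Finset.card_univ, le_refl]
  calc _ ≤ √(Fintype.card Y) * √N / N := by gcongr
    _ = _ := by
      rw [mul_div_assoc, Real.sqrt_div_self', mul_one_div]

/-- The mean `ℓ¹` distance between the empirical distribution of independent draws and the average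
of their laws. -/
theorem integral_l1dist_empirical_le [MeasurableSpace S] [DiscreteMeasurableSpace S]
    {N : ℕ} [NeZero N] (p : Fin N → Prob S) :
    ∫ s, ∑ a, |empirical s a - (∑ j, p j a) / N| ∂Measure.pi (fun j => (p j).law)
      ≤ √(Fintype.card S) / √N := by
  classical
  have h := integral_sum_abs_average_sub_le p
    fun _ a => (⟨Pi.single a 1, single_mem_stdSimplex ℝ a⟩ : Prob S)
  refine le_of_eq_of_le (integral_congr_ae (.of_forall fun s =>
    Finset.sum_congr rfl fun a _ => ?_)) h
  have h1 := sum_empirical_mul s fun b => (Pi.single b 1 : S → ℝ) a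
  have h2 : ∀ j, ∑ b, p j b * (Pi.single b 1 : S → ℝ) a = p j a := fun j => by
    simp [Pi.single_apply]
  have h3 : ∑ b, empirical s b * (Pi.single b 1 : S → ℝ) a = empirical s a := by
    simp [Pi.single_apply]
  rw [h3] at h1
  rw [h1]
  simp only [← h2]
  rfl

end Simplex

section Stability

variable {X U : Type*} [Fintype X] [Fintype U]

/-- `∑ₓ ∑ᵤ r(x, μ, u, ν(μ, h)) μ(x) h(x)(u)`: the mean reward when `x ∼ μ` and `u ∼ h(x)`. -/
def meanReward (r : Reward X U) (μ : Prob X) (h : X → Prob U) : ℝ :=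
  ∑ x, ∑ u, μ x * h x u * r x μ u (actionDist μ h)

/-- The `ℓ¹` distance between the joint laws of state and action. -/
theorem sum_abs_joint_sub_le {L : ℝ} (μ₁ μ₂ : Prob X) (h₁ h₂ : X → Prob U)
    (hh : ∀ x, l1dist (h₁ x) (h₂ x) ≤ L * l1dist μ₁ μ₂) :
    ∑ x, ∑ u, |μ₁ x * h₁ x u - μ₂ x * h₂ x u| ≤ (1 + L) * l1dist μ₁ μ₂ := by
  have h1 : ∀ x, ∑ u, |μ₁ x * h₁ x u - μ₂ x * h₂ x u| ≤
      |μ₁ x - μ₂ x| + μ₁ x * (L * l1dist μ₁ μ₂) := by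
    intro x
    calc _ ≤ ∑ u, (|μ₁ x - μ₂ x| * h₂ x u + μ₁ x * |h₁ x u - h₂ x u|) := by
          refine Finset.sum_le_sum fun u _ => ?_
          rw [show μ₁ x * h₁ x u - μ₂ x * h₂ x u
            = (μ₁ x - μ₂ x) * h₂ x u + μ₁ x * (h₁ x u - h₂ x u) by ring]
          refine (abs_add_le _ _).trans_eq ?_
          rw [abs_mul, abs_mul, abs_of_nonneg ((h₂ x).nonneg u), abs_of_nonneg (μ₁.nonneg x)]
      _ = |μ₁ x - μ₂ x| + μ₁ x * l1dist (h₁ x) (h₂ x) := by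
          rw [Finset.sum_add_distrib, ← Finset.mul_sum, ← Finset.mul_sum, Prob.sum_eq_one, mul_one,
            l1dist]
      _ ≤ _ := by
          gcongr
          · exact μ₁.nonneg x
          · exact hh x
  refine (Finset.sum_le_sum fun x _ => h1 x).trans_eq ?_
  rw [Finset.sum_add_distrib, ← Finset.sum_mul, Prob.sum_eq_one, l1dist]
  ring

theorem l1dist_actionDist_le {L : ℝ} (μ₁ μ₂ : Prob X) (h₁ h₂ : X → Prob U)
    (hh : ∀ x, l1dist (h₁ x) (h₂ x) ≤ L * l1dist μ₁ μ₂) :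
    l1dist (actionDist μ₁ h₁) (actionDist μ₂ h₂) ≤ (1 + L) * l1dist μ₁ μ₂ := by
  refine le_trans ?_ (sum_abs_joint_sub_le μ₁ μ₂ h₁ h₂ hh)
  rw [Finset.sum_comm]
  refine Finset.sum_le_sum fun u _ => ?_
  change |∑ x, h₁ x u * μ₁ x - ∑ x, h₂ x u * μ₂ x| ≤ _
  rw [← Finset.sum_sub_distrib]
  refine (Finset.abs_sum_le_sum_abs _ _).trans_eq ?_
  simp only [mul_comm]

theorem sum_joint (μ : Prob X) (h : X → Prob U) : ∑ x, ∑ u, μ x * h x u = 1 := by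
  simp only [← Finset.mul_sum, Prob.sum_eq_one, mul_one]

/-- Perturbation of a mean `∑ₓ ∑ᵤ w(x, u) f(x, u)` in both the weights and the integrand. -/
theorem abs_sum_mul_sub_sum_mul_le (w₁ w₂ f₁ f₂ : X → U → ℝ) (hw : ∀ x u, 0 ≤ w₁ x u) :
    |∑ x, ∑ u, w₁ x u * f₁ x u - ∑ x, ∑ u, w₂ x u * f₂ x u| ≤
      ∑ x, ∑ u, (w₁ x u * |f₁ x u - f₂ x u| + |w₁ x u - w₂ x u| * |f₂ x u|) := by
  rw [← Finset.sum_sub_distrib]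
  refine (Finset.abs_sum_le_sum_abs _ _).trans (Finset.sum_le_sum fun x _ => ?_)
  rw [← Finset.sum_sub_distrib]
  refine (Finset.abs_sum_le_sum_abs _ _).trans (Finset.sum_le_sum fun u _ => ?_)
  rw [show w₁ x u * f₁ x u - w₂ x u * f₂ x u
    = w₁ x u * (f₁ x u - f₂ x u) + (w₁ x u - w₂ x u) * f₂ x u by ring]
  refine (abs_add_le _ _).trans_eq ?_
  rw [abs_mul, abs_mul, abs_of_nonneg (hw x u)]

theorem nextStateDist_apply (P : Transition X U) (μ : Prob X) (h : X → Prob U) (y : X) :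
    nextStateDist P μ h y = ∑ x, ∑ u, μ x * h x u * P x μ u (actionDist μ h) y := by
  change ∑ x, ∑ u, P x μ u (actionDist μ h) y * μ x * h x u = _
  refine Finset.sum_congr rfl fun x _ => Finset.sum_congr rfl fun u _ => by ring

theorem l1dist_nextStateDist_le {P : Transition X U} {LP L : ℝ} (hLP : 0 ≤ LP) (hL : 0 ≤ L)
    (hP : P.LipschitzBound LP) (μ₁ μ₂ : Prob X) (h₁ h₂ : X → Prob U)
    (hh : ∀ x, l1dist (h₁ x) (h₂ x) ≤ L * l1dist μ₁ μ₂) :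
    l1dist (nextStateDist P μ₁ h₁) (nextStateDist P μ₂ h₂) ≤
      (2 * LP + 1) * (1 + L) * l1dist μ₁ μ₂ := by
  have hν := l1dist_actionDist_le μ₁ μ₂ h₁ h₂ hh
  have hw := sum_abs_joint_sub_le μ₁ μ₂ h₁ h₂ hh
  have hd := l1dist_nonneg μ₁ μ₂
  set ν₁ := actionDist μ₁ h₁ with hν₁
  set ν₂ := actionDist μ₂ h₂ with hν₂
  calc l1dist (nextStateDist P μ₁ h₁) (nextStateDist P μ₂ h₂)
      ≤ ∑ y, ∑ x, ∑ u, (μ₁ x * h₁ x u * |P x μ₁ u ν₁ y - P x μ₂ u ν₂ y|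
          + |μ₁ x * h₁ x u - μ₂ x * h₂ x u| * |P x μ₂ u ν₂ y|) := by
        refine Finset.sum_le_sum fun y _ => ?_
        rw [nextStateDist_apply, nextStateDist_apply]
        exact abs_sum_mul_sub_sum_mul_le (fun x u => μ₁ x * h₁ x u) (fun x u => μ₂ x * h₂ x u)
          (fun x u => P x μ₁ u ν₁ y) (fun x u => P x μ₂ u ν₂ y)
          fun x u => mul_nonneg (μ₁.nonneg x) ((h₁ x).nonneg u)
    _ = ∑ x, ∑ u, (μ₁ x * h₁ x u * l1dist (P x μ₁ u ν₁) (P x μ₂ u ν₂)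
          + |μ₁ x * h₁ x u - μ₂ x * h₂ x u|) := by
        rw [Finset.sum_comm]
        refine Finset.sum_congr rfl fun x _ => ?_
        rw [Finset.sum_comm]
        refine Finset.sum_congr rfl fun u _ => ?_
        simp only [abs_of_nonneg (Prob.nonneg _ _)]
        rw [Finset.sum_add_distrib, ← Finset.mul_sum, ← Finset.mul_sum, Prob.sum_eq_one, mul_one,
          l1dist]
    _ ≤ ∑ x, ∑ u, (μ₁ x * h₁ x u * (LP * (l1dist μ₁ μ₂ + (1 + L) * l1dist μ₁ μ₂))
          + |μ₁ x * h₁ x u - μ₂ x * h₂ x u|) := by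
        refine Finset.sum_le_sum fun x _ => Finset.sum_le_sum fun u _ => ?_
        gcongr
        · exact mul_nonneg (μ₁.nonneg x) ((h₁ x).nonneg u)
        · refine (hP x u μ₁ μ₂ ν₁ ν₂).trans ?_
          gcongr
    _ ≤ LP * (l1dist μ₁ μ₂ + (1 + L) * l1dist μ₁ μ₂) + (1 + L) * l1dist μ₁ μ₂ := by
        simp only [Finset.sum_add_distrib, ← Finset.sum_mul]
        rw [sum_joint, one_mul]
        gcongr
    _ ≤ _ := by
        have := mul_nonneg (mul_nonneg hLP hL) hd
        linarith

theorem abs_meanReward_sub_le {r : Reward X U} {R Lr L : ℝ} (hLr : 0 ≤ Lr) (hR : 0 ≤ R)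
    (hr : r.Regular R Lr) (μ₁ μ₂ : Prob X) (h₁ h₂ : X → Prob U)
    (hh : ∀ x, l1dist (h₁ x) (h₂ x) ≤ L * l1dist μ₁ μ₂) :
    |meanReward r μ₁ h₁ - meanReward r μ₂ h₂| ≤
      (Lr * (2 + L) + R * (1 + L)) * l1dist μ₁ μ₂ := by
  have hν := l1dist_actionDist_le μ₁ μ₂ h₁ h₂ hh
  have hw := sum_abs_joint_sub_le μ₁ μ₂ h₁ h₂ hh
  set ν₁ := actionDist μ₁ h₁ with hν₁
  set ν₂ := actionDist μ₂ h₂ with hν₂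
  have hw₁ : ∀ x u, 0 ≤ μ₁ x * h₁ x u := fun x u => mul_nonneg (μ₁.nonneg x) ((h₁ x).nonneg u)
  calc _ ≤ ∑ x, ∑ u, (μ₁ x * h₁ x u * |r x μ₁ u ν₁ - r x μ₂ u ν₂|
          + |μ₁ x * h₁ x u - μ₂ x * h₂ x u| * |r x μ₂ u ν₂|) :=
        abs_sum_mul_sub_sum_mul_le (fun x u => μ₁ x * h₁ x u) (fun x u => μ₂ x * h₂ x u)
          (fun x u => r x μ₁ u ν₁) (fun x u => r x μ₂ u ν₂) hw₁
    _ ≤ ∑ x, ∑ u, (μ₁ x * h₁ x u * (Lr * (l1dist μ₁ μ₂ + (1 + L) * l1dist μ₁ μ₂))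
          + |μ₁ x * h₁ x u - μ₂ x * h₂ x u| * R) := by
        refine Finset.sum_le_sum fun x _ => Finset.sum_le_sum fun u _ => ?_
        gcongr
        · exact hw₁ x u
        · refine (hr.2 x u μ₁ μ₂ ν₁ ν₂).trans ?_
          gcongr
        · exact hr.1 _ _ _ _
    _ ≤ Lr * (l1dist μ₁ μ₂ + (1 + L) * l1dist μ₁ μ₂) + (1 + L) * l1dist μ₁ μ₂ * R := by
        simp only [Finset.sum_add_distrib, ← Finset.sum_mul]
        rw [sum_joint, one_mul]
        gcongr
    _ = _ := by ring

end Stability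

section PathIntegrals

variable {A B : Type*} [MeasurableSpace A] [MeasurableSpace B]

instance (m : Measure A) [IsProbabilityMeasure m] (act : ℕ → Kernel A B)
    (tr : ℕ → Kernel (A × B) A) [∀ t, IsMarkovKernel (act t)] [∀ t, IsMarkovKernel (tr t)] :
    IsProbabilityMeasure (pathLaw m act tr) := by
  unfold pathLaw
  infer_instance

variable (m : Measure A) [IsProbabilityMeasure m] (act : ℕ → Kernel A B)
  (tr : ℕ → Kernel (A × B) A) [∀ t, IsMarkovKernel (act t)] [∀ t, IsMarkovKernel (tr t)]

theorem map_succ_pathLaw_eq_compProd (t : ℕ) :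
    (pathLaw m act tr).map (fun ω => ω (t + 1)) =
      (tr t ∘ₘ (pathLaw m act tr).map (fun ω => ω t)) ⊗ₘ act (t + 1) := by
  have : IsProbabilityMeasure ((pathLaw m act tr).map (fun ω => ω t)) :=
    Measure.isProbabilityMeasure_map (Measurable.aemeasurable (by fun_prop))
  rw [map_succ_pathLaw, stepKernel, Kernel.compProd_prodMkLeft_eq_comp, ← Measure.comp_assoc,
    Measure.compProd_eq_comp_prod (_ ∘ₘ _)]

theorem map_state_succ_pathLaw (t : ℕ) :
    (pathLaw m act tr).map (fun ω => (ω (t + 1)).1) =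
      tr t ∘ₘ (pathLaw m act tr).map (fun ω => ω t) := by
  have : IsProbabilityMeasure ((pathLaw m act tr).map (fun ω => ω t)) :=
    Measure.isProbabilityMeasure_map (Measurable.aemeasurable (by fun_prop))
  have h0 : (fun ω : ℕ → A × B => (ω (t + 1)).1) = Prod.fst ∘ fun ω => ω (t + 1) := rfl
  rw [h0, ← Measure.map_map (by fun_prop) (by fun_prop), map_succ_pathLaw_eq_compProd]
  exact Measure.fst_compProd _ _

theorem map_pathLaw_eq_compProd (t : ℕ) :
    (pathLaw m act tr).map (fun ω => ω t) =
      (pathLaw m act tr).map (fun ω => (ω t).1) ⊗ₘ act t := by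
  cases t with
  | zero =>
    have h0 : (fun ω : ℕ → A × B => (ω 0).1) = Prod.fst ∘ fun ω => ω 0 := rfl
    rw [h0, ← Measure.map_map (by fun_prop) (by fun_prop), map_zero_pathLaw]
    congr 1
    exact (Measure.fst_compProd _ _).symm
  | succ t => rw [map_state_succ_pathLaw, map_succ_pathLaw_eq_compProd]

variable [Finite A] [Finite B] [DiscreteMeasurableSpace A] [DiscreteMeasurableSpace B]

theorem integral_pathLaw (t : ℕ) (f : A × B → ℝ) :
    ∫ ω, f (ω t) ∂pathLaw m act tr =
      ∫ ω, ∫ b, f ((ω t).1, b) ∂act t (ω t).1 ∂pathLaw m act tr := by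
  have : IsProbabilityMeasure ((pathLaw m act tr).map (fun ω => (ω t).1)) :=
    Measure.isProbabilityMeasure_map (Measurable.aemeasurable (by fun_prop))
  rw [← integral_map (φ := fun ω : ℕ → A × B => ω t) (f := f) (Measurable.aemeasurable (by fun_prop))
    Measurable.of_discrete.aestronglyMeasurable, map_pathLaw_eq_compProd,
    Measure.integral_compProd Integrable.of_finite,
    integral_map (Measurable.aemeasurable (by fun_prop)) Measurable.of_discrete.aestronglyMeasurable]

theorem integral_pathLaw_state_succ (t : ℕ) (f : A → ℝ) :
    ∫ ω, f (ω (t + 1)).1 ∂pathLaw m act tr =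
      ∫ ω, ∫ b, ∫ a, f a ∂tr t ((ω t).1, b) ∂act t (ω t).1 ∂pathLaw m act tr := by
  have : IsProbabilityMeasure ((pathLaw m act tr).map (fun ω => ω t)) :=
    Measure.isProbabilityMeasure_map (Measurable.aemeasurable (by fun_prop))
  rw [← integral_pathLaw m act tr t fun z => ∫ a, f a ∂tr t z,
    ← integral_map (φ := fun ω : ℕ → A × B => (ω (t + 1)).1) (f := f) (Measurable.aemeasurable (by fun_prop))
    Measurable.of_discrete.aestronglyMeasurable, map_state_succ_pathLaw,
    ← Measure.snd_compProd, Measure.snd, integral_map measurable_snd.aemeasurable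
      Measurable.of_discrete.aestronglyMeasurable, Measure.integral_compProd Integrable.of_finite,
    integral_map (Measurable.aemeasurable (by fun_prop)) Measurable.of_discrete.aestronglyMeasurable]


end PathIntegrals

/-- Fubini for a discounted series of uniformly bounded functions. -/
theorem hasSum_integral_discounted {Ω : Type*} [MeasurableSpace Ω] (M : Measure Ω)
    [IsProbabilityMeasure M] {γ R : ℝ} (hγ0 : 0 ≤ γ) (hγ1 : γ < 1) (f : ℕ → Ω → ℝ)
    (hf : ∀ t, Measurable (f t)) (hR : ∀ t ω, |f t ω| ≤ R) :
    HasSum (fun t => γ ^ t * ∫ ω, f t ω ∂M) (∫ ω, ∑' t, γ ^ t * f t ω ∂M) := by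
  have hb : ∀ t ω, ‖γ ^ t * f t ω‖ ≤ γ ^ t * R := fun t ω => by
    rw [Real.norm_eq_abs, abs_mul, abs_of_nonneg (pow_nonneg hγ0 t)]
    exact mul_le_mul_of_nonneg_left (hR t ω) (pow_nonneg hγ0 t)
  have hs : Summable fun t => γ ^ t * R := (summable_geometric_of_lt_one hγ0 hγ1).mul_right R
  have hi : ∀ t, Integrable (fun ω => γ ^ t * f t ω) M := fun t =>
    Integrable.of_bound ((hf t).const_mul _).aestronglyMeasurable (γ ^ t * R)
      (.of_forall (hb t))
  have h := hasSum_integral_of_summable_integral_norm hi ?_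
  · simpa only [integral_const_mul] using h
  · refine hs.of_nonneg_of_le (fun t => integral_nonneg fun ω => norm_nonneg _) fun t => ?_
    refine (integral_mono (hi t).norm (integrable_const (γ ^ t * R)) (hb t)).trans_eq ?_
    simp

section OneStep

variable {X U : Type*} [Fintype X] [Fintype U] {N : ℕ} [NeZero N]

theorem meanReward_empirical (r : Reward X U) (x : Fin N → X) (h : X → Prob U) :
    meanReward r (empirical x) h =
      (∑ j, ∑ u, h (x j) u * r (x j) (empirical x) u (actionDist (empirical x) h)) / N := by
  rw [← sum_empirical_mul x fun b => ∑ u, h b u * r b (empirical x) u (actionDist (empirical x) h)]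
  simp only [meanReward, Finset.mul_sum, mul_assoc]

theorem nextStateDist_empirical (P : Transition X U) (x : Fin N → X) (h : X → Prob U) (y : X) :
    nextStateDist P (empirical x) h y =
      (∑ j, ∑ u, h (x j) u * P (x j) (empirical x) u (actionDist (empirical x) h) y) / N := by
  rw [nextStateDist_apply]
  exact meanReward_empirical (fun a μ u ν => P a μ u ν y) x h

variable [MeasurableSpace U] [DiscreteMeasurableSpace U]

theorem integral_l1dist_empirical_actionDist_le (x : Fin N → X) (h : X → Prob U) :
    ∫ u, l1dist (empirical u) (actionDist (empirical x) h)
        ∂Measure.pi (fun j => (h (x j)).law) ≤ √(Fintype.card U) / √N := by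
  refine le_of_eq_of_le (integral_congr_ae (.of_forall fun u =>
    Finset.sum_congr rfl fun a _ => ?_)) (integral_l1dist_empirical_le fun j => h (x j))
  rw [← sum_empirical_mul x fun b => h b a]
  change |_ - ∑ b, h b a * empirical x b| = _
  simp only [mul_comm]

theorem abs_integral_averageReward_sub_meanReward_le {r : Reward X U} {R Lr : ℝ} (hLr : 0 ≤ Lr)
    (hr : r.Regular R Lr) (x : Fin N → X) (h : X → Prob U) :
    |∫ u, (∑ j, r (x j) (empirical x) (u j) (empirical u)) / N
        ∂Measure.pi (fun j => (h (x j)).law) - meanReward r (empirical x) h| ≤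
      Lr * (√(Fintype.card U) / √N) := by
  set M := Measure.pi (fun j => (h (x j)).law) with hM
  set μ := empirical x with hμ
  set ν := actionDist μ h with hν
  have hN : (0 : ℝ) < N := by exact_mod_cast Nat.pos_of_ne_zero (NeZero.ne N)
  have hmean : meanReward r μ h = ∫ u, (∑ j, r (x j) μ (u j) ν) / N ∂M := by
    rw [integral_div, integral_finsetSum _ fun j _ => Integrable.of_finite, hμ,
      meanReward_empirical]
    congr 1
    refine Finset.sum_congr rfl fun j _ => ?_
    rw [← integral_law]
    exact (integral_comp_eval (μ := fun j => (h (x j)).law) (f := fun a => r (x j) μ a ν)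
      Measurable.of_discrete.aestronglyMeasurable).symm
  rw [hmean, ← integral_sub Integrable.of_finite Integrable.of_finite]
  refine (abs_integral_le_integral_abs).trans ?_
  calc _ ≤ ∫ u, Lr * l1dist (empirical u) ν ∂M := by
        refine integral_mono Integrable.of_finite Integrable.of_finite fun u => ?_
        simp only
        rw [← sub_div, ← Finset.sum_sub_distrib, abs_div, abs_of_pos hN, div_le_iff₀ hN]
        refine (Finset.abs_sum_le_sum_abs _ _).trans ?_
        refine (Finset.sum_le_card_nsmul Finset.univ _ (Lr * l1dist (empirical u) ν)
          fun j _ => ?_).trans_eq ?_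
        · refine (hr.2 (x j) (u j) μ μ (empirical u) ν).trans_eq ?_
          rw [l1dist_self, zero_add]
        · simp [mul_comm]
    _ ≤ _ := by
        rw [integral_const_mul]
        exact mul_le_mul_of_nonneg_left (integral_l1dist_empirical_actionDist_le x h) hLr

variable [MeasurableSpace X] [DiscreteMeasurableSpace X]

theorem integral_l1dist_empirical_nextStateDist_le {P : Transition X U} {LP : ℝ} (hLP : 0 ≤ LP)
    (hP : P.LipschitzBound LP) (x : Fin N → X) (h : X → Prob U) :
    ∫ u, ∫ y, l1dist (empirical y) (nextStateDist P (empirical x) h)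
          ∂Measure.pi (fun j => (P (x j) (empirical x) (u j) (empirical u)).law)
        ∂Measure.pi (fun j => (h (x j)).law) ≤
      (2 * √(Fintype.card X) + LP * √(Fintype.card U)) / √N := by
  set M := Measure.pi (fun j => (h (x j)).law) with hM
  set μ := empirical x with hμ
  set ν := actionDist μ h with hν
  have hN : (0 : ℝ) < N := by exact_mod_cast Nat.pos_of_ne_zero (NeZero.ne N)
  let dev : (Fin N → U) → ℝ := fun u =>
    ∑ y, |(∑ j, P (x j) μ (u j) ν y) / N - nextStateDist P μ h y|
  have hdev : ∫ u, dev u ∂M ≤ √(Fintype.card X) / √N := by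
    have := integral_sum_abs_average_sub_le (fun j => h (x j)) fun j a => P (x j) μ a ν
    simpa only [dev, hμ, nextStateDist_empirical] using this
  have hlip : ∀ u : Fin N → U, ∑ y, |(∑ j, P (x j) μ (u j) (empirical u) y) / N -
      (∑ j, P (x j) μ (u j) ν y) / N| ≤ LP * l1dist (empirical u) ν := by
    intro u
    calc _ ≤ ∑ y, (∑ j, |P (x j) μ (u j) (empirical u) y - P (x j) μ (u j) ν y|) / N := by
          refine Finset.sum_le_sum fun y _ => ?_
          rw [← sub_div, ← Finset.sum_sub_distrib, abs_div, abs_of_pos hN]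
          gcongr
          exact Finset.abs_sum_le_sum_abs _ _
      _ = (∑ j, l1dist (P (x j) μ (u j) (empirical u)) (P (x j) μ (u j) ν)) / N := by
          rw [← Finset.sum_div, Finset.sum_comm]
          rfl
      _ ≤ _ := by
          rw [div_le_iff₀ hN]
          refine (Finset.sum_le_card_nsmul Finset.univ _ (LP * l1dist (empirical u) ν)
            fun j _ => ?_).trans_eq ?_
          · refine (hP (x j) (u j) μ μ (empirical u) ν).trans_eq ?_
            rw [l1dist_self, zero_add]
          · simp [mul_comm]
  have hinner : ∀ u : Fin N → U, ∫ y, l1dist (empirical y) (nextStateDist P μ h)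
        ∂Measure.pi (fun j => (P (x j) μ (u j) (empirical u)).law) ≤
      √(Fintype.card X) / √N + (LP * l1dist (empirical u) ν + dev u) := by
    intro u
    set Q := Measure.pi (fun j => (P (x j) μ (u j) (empirical u)).law)
    calc _ ≤ ∫ y, (∑ a, |empirical y a - (∑ j, P (x j) μ (u j) (empirical u) a) / N| +
          (LP * l1dist (empirical u) ν + dev u)) ∂Q := by
          refine integral_mono Integrable.of_finite Integrable.of_finite fun y => ?_
          refine le_trans ?_ (add_le_add_right (add_le_add_left (hlip u) (dev u)) _)
          simp only [dev]
          rw [← Finset.sum_add_distrib, ← Finset.sum_add_distrib]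
          refine Finset.sum_le_sum fun a _ => ?_
          exact (abs_sub_le _ _ _).trans (add_le_add_right (abs_sub_le _ _ _) _)
      _ ≤ _ := by
          rw [integral_add Integrable.of_finite Integrable.of_finite]
          refine add_le_add (integral_l1dist_empirical_le _) ?_
          simp
  calc _ ≤ ∫ u, (√(Fintype.card X) / √N + (LP * l1dist (empirical u) ν + dev u)) ∂M :=
        integral_mono Integrable.of_finite Integrable.of_finite hinner
    _ = √(Fintype.card X) / √N + (LP * ∫ u, l1dist (empirical u) ν ∂M + ∫ u, dev u ∂M) := by
        rw [integral_add Integrable.of_finite Integrable.of_finite,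
          integral_add Integrable.of_finite Integrable.of_finite, integral_const_mul]
        simp
    _ ≤ √(Fintype.card X) / √N +
        (LP * (√(Fintype.card U) / √N) + √(Fintype.card X) / √N) := by
        gcongr
        exact integral_l1dist_empirical_actionDist_le x h
    _ = _ := by ring

end OneStep

section Approximation

variable {X U : Type*} [Fintype X] [Fintype U]
  [MeasurableSpace X] [DiscreteMeasurableSpace X]
  [MeasurableSpace U] [DiscreteMeasurableSpace U]

instance (P : Transition X U) (π : Policy X U) (μ : Prob X) :
    IsProbabilityMeasure (mfcLaw P π μ) := by
  unfold mfcLaw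
  infer_instance

theorem hasSum_mfcValue {γ R Lr : ℝ} (hγ0 : 0 ≤ γ) (hγ1 : γ < 1) {r : Reward X U}
    (hr : r.Regular R Lr) (P : Transition X U) (π : Policy X U) (μ : Prob X) :
    HasSum (fun t => γ ^ t * meanReward r (stateFlow P π μ t) (π t (stateFlow P π μ t)))
      (mfcValue γ r P π μ) := by
  let f : ℕ → X × U → ℝ := fun t z => r z.1 (stateFlow P π μ t) z.2 (actionFlow P π μ t)
  have h := hasSum_integral_discounted (mfcLaw P π μ) hγ0 hγ1 (fun t ω => f t (ω t))
    (fun t => (Measurable.of_discrete (f := f t)).comp (measurable_pi_apply t))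
    (fun t ω => hr.1 _ _ _ _)
  refine (congrArg (HasSum · _) (funext fun t => congrArg (γ ^ t * ·) ?_)).mpr h
  rw [mfcLaw, integral_pathLaw, ← mfcLaw]
  change _ = ∫ ω, (fun a => ∫ b, f t (a, b) ∂mfcAct P π μ t a) ((ω t).1) ∂mfcLaw P π μ
  rw [← integral_map (φ := fun ω : ℕ → X × U => (ω t).1)
    (f := fun a => ∫ b, f t (a, b) ∂mfcAct P π μ t a) (Measurable.aemeasurable (by fun_prop))
    Measurable.of_discrete.aestronglyMeasurable, map_state_mfcLaw, integral_law]
  simp only [meanReward, mul_assoc, ← Finset.mul_sum]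
  refine Finset.sum_congr rfl fun x _ => ?_
  congr 1
  exact (integral_law _ _).symm

variable {N : ℕ} [NeZero N]

instance (P : Transition X U) (π : Policy X U) (x : Fin N → X) :
    IsProbabilityMeasure (marlLaw P π x) := by
  unfold marlLaw
  infer_instance

theorem integrable_marlLaw (P : Transition X U) (π : Policy X U) (x : Fin N → X) (t : ℕ)
    (f : (Fin N → X) × (Fin N → U) → ℝ) : Integrable (fun ω => f (ω t)) (marlLaw P π x) :=
  Integrable.comp_measurable (f := fun ω : ℕ → (Fin N → X) × (Fin N → U) => ω t) (g := f)
    Integrable.of_finite (measurable_pi_apply t)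

theorem hasSum_marlValue {γ R Lr : ℝ} (hγ0 : 0 ≤ γ) (hγ1 : γ < 1) {r : Reward X U}
    (hr : r.Regular R Lr) (P : Transition X U) (π : Policy X U) (x : Fin N → X) :
    HasSum (fun t => γ ^ t * ∫ ω, (∑ j, r ((ω t).1 j) (empirical (ω t).1) ((ω t).2 j)
      (empirical (ω t).2)) / N ∂marlLaw P π x) (marlValue γ r P π x) := by
  let f : Fin N → (Fin N → X) × (Fin N → U) → ℝ := fun j z =>
    r (z.1 j) (empirical z.1) (z.2 j) (empirical z.2)
  have h := fun j => hasSum_integral_discounted (marlLaw P π x) hγ0 hγ1 (fun t ω => f j (ω t))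
    (fun t => (Measurable.of_discrete (f := f j)).comp (measurable_pi_apply t))
    (fun t ω => hr.1 _ _ _ _)
  refine (congrArg (HasSum · _) (funext fun t => ?_)).mpr
    ((hasSum_sum fun j (_ : j ∈ Finset.univ) => h j).mul_left (1 / (N : ℝ)))
  rw [← Finset.mul_sum, ← integral_finsetSum _ fun j _ => integrable_marlLaw P π x t (f j),
    integral_div]
  ring

/-- The mean `ℓ¹` distance at time `t` between the empirical state distribution of the `N` agents
and the mean-field state distribution. -/
def stateGap (P : Transition X U) (π : Policy X U) (x : Fin N → X) (t : ℕ) : ℝ :=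
  ∫ ω, l1dist (empirical (ω t).1) (stateFlow P π (empirical x) t) ∂marlLaw P π x

theorem stateGap_zero (P : Transition X U) (π : Policy X U) (x : Fin N → X) :
    stateGap P π x 0 = 0 := by
  let f : (Fin N → X) × (Fin N → U) → ℝ := fun z => l1dist (empirical z.1) (empirical x)
  change ∫ ω, f (ω 0) ∂marlLaw P π x = 0
  rw [← integral_map (φ := fun ω : ℕ → (Fin N → X) × (Fin N → U) => ω 0) (f := f)
    (Measurable.aemeasurable (by fun_prop)) Measurable.of_discrete.aestronglyMeasurable, marlLaw,
    map_zero_pathLaw, Measure.integral_compProd Integrable.of_finite, integral_dirac]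
  simp [f, l1dist_self]

theorem stateGap_succ_le {P : Transition X U} {π : Policy X U} {LP L : ℝ} (hLP : 0 ≤ LP)
    (hL : 0 ≤ L) (hP : P.LipschitzBound LP) (hπ : π.LipschitzBound L) (x : Fin N → X) (t : ℕ) :
    stateGap P π x (t + 1) ≤ (2 * √(Fintype.card X) + LP * √(Fintype.card U)) / √N +
      (2 * LP + 1) * (1 + L) * stateGap P π x t := by
  set m := stateFlow P π (empirical x) with hm
  set C := (2 * √(Fintype.card X) + LP * √(Fintype.card U)) / √N with hC
  set S := (2 * LP + 1) * (1 + L) with hS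
  have key : ∀ z : Fin N → X,
      ∫ u, ∫ y, l1dist (empirical y) (m (t + 1)) ∂marlTrans P (z, u) ∂marlAct π t z ≤
        C + S * l1dist (empirical z) (m t) := by
    intro z
    set h := π t (empirical z) with hh
    calc _ ≤ ∫ u, (∫ y, l1dist (empirical y) (nextStateDist P (empirical z) h)
            ∂marlTrans P (z, u) + S * l1dist (empirical z) (m t)) ∂marlAct π t z := by
          refine integral_mono Integrable.of_finite Integrable.of_finite fun u => ?_
          simp only
          calc _ ≤ ∫ y, (l1dist (empirical y) (nextStateDist P (empirical z) h) +
                S * l1dist (empirical z) (m t)) ∂marlTrans P (z, u) := by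
                refine integral_mono Integrable.of_finite Integrable.of_finite fun y => ?_
                refine (l1dist_triangle _ (nextStateDist P (empirical z) h) _).trans ?_
                exact add_le_add_right (l1dist_nextStateDist_le hLP hL hP _ _ _ _
                  fun a => hπ t a _ _) _
            _ = _ := by
                rw [integral_add Integrable.of_finite Integrable.of_finite]
                simp
      _ = ∫ u, ∫ y, l1dist (empirical y) (nextStateDist P (empirical z) h)
            ∂marlTrans P (z, u) ∂marlAct π t z + S * l1dist (empirical z) (m t) := by
          rw [integral_add Integrable.of_finite Integrable.of_finite]
          simp
      _ ≤ _ := add_le_add_left (integral_l1dist_empirical_nextStateDist_le hLP hP z h) _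
  calc stateGap P π x (t + 1)
      = ∫ ω, ∫ u, ∫ y, l1dist (empirical y) (m (t + 1)) ∂marlTrans P ((ω t).1, u)
          ∂marlAct π t (ω t).1 ∂marlLaw P π x :=
        integral_pathLaw_state_succ (Measure.dirac x) (marlAct π) (fun _ => marlTrans P) t
          fun y => l1dist (empirical y) (m (t + 1))
    _ ≤ ∫ ω, (C + S * l1dist (empirical (ω t).1) (m t)) ∂marlLaw P π x :=
        integral_mono
          (integrable_marlLaw P π x t fun z => ∫ u, ∫ y, l1dist (empirical y) (m (t + 1))
            ∂marlTrans P (z.1, u) ∂marlAct π t z.1)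
          (integrable_marlLaw P π x t fun z => C + S * l1dist (empirical z.1) (m t))
          fun ω => key (ω t).1
    _ = C + S * stateGap P π x t := by
        rw [integral_add (integrable_const _)
          (integrable_marlLaw P π x t fun z => S * l1dist (empirical z.1) (m t)),
          integral_const_mul]
        simp [stateGap, hm]

theorem stateGap_le {P : Transition X U} {π : Policy X U} {LP L : ℝ} (hLP : 0 < LP)
    (hL : 0 ≤ L) (hP : P.LipschitzBound LP) (hπ : π.LipschitzBound L) (x : Fin N → X) (t : ℕ) :
    stateGap P π x t ≤ (2 * √(Fintype.card X) + LP * √(Fintype.card U)) / √N /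
      ((2 * LP + 1) * (1 + L) - 1) * ((2 * LP + 1) * (1 + L)) ^ t := by
  have hrec := stateGap_succ_le hLP.le hL hP hπ x
  set C := (2 * √(Fintype.card X) + LP * √(Fintype.card U)) / √N with hC
  set S := (2 * LP + 1) * (1 + L) with hS
  have hS1 : 0 < S - 1 := by
    have := mul_nonneg hLP.le hL
    linarith
  have hC0 : 0 ≤ C := by positivity
  have h : stateGap P π x t ≤ C / (S - 1) * (S ^ t - 1) := by
    induction t with
    | zero => simp [stateGap_zero]
    | succ t ih =>
      calc _ ≤ C + S * (C / (S - 1) * (S ^ t - 1)) := by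
            refine (hrec t).trans ?_
            have : 0 ≤ S := by linarith
            gcongr
        _ = _ := by
            field_simp
            ring
  refine h.trans ?_
  have := div_nonneg hC0 hS1.le
  nlinarith

theorem abs_integral_averageReward_sub_le {r : Reward X U} {P : Transition X U}
    {π : Policy X U} {R Lr L : ℝ} (hR : 0 ≤ R) (hLr : 0 ≤ Lr) (hr : r.Regular R Lr)
    (hπ : π.LipschitzBound L) (x : Fin N → X) (t : ℕ) :
    |∫ ω, (∑ j, r ((ω t).1 j) (empirical (ω t).1) ((ω t).2 j) (empirical (ω t).2)) / N
        ∂marlLaw P π x - meanReward r (stateFlow P π (empirical x) t)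
          (π t (stateFlow P π (empirical x) t))| ≤
      Lr * (√(Fintype.card U) / √N) + (Lr * (2 + L) + R * (1 + L)) * stateGap P π x t := by
  set m := stateFlow P π (empirical x) t with hm
  let g : (Fin N → X) × (Fin N → U) → ℝ := fun z =>
    (∑ j, r (z.1 j) (empirical z.1) (z.2 j) (empirical z.2)) / N
  let G : (Fin N → X) × (Fin N → U) → ℝ := fun z => ∫ u, g (z.1, u) ∂marlAct π t z.1
  have h1 : ∫ ω, g (ω t) ∂marlLaw P π x = ∫ ω, G (ω t) ∂marlLaw P π x :=
    integral_pathLaw (Measure.dirac x) (marlAct π) (fun _ => marlTrans P) t g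
  have h2 : ∫ ω, g (ω t) ∂marlLaw P π x - meanReward r m (π t m) =
      ∫ ω, (G (ω t) - meanReward r m (π t m)) ∂marlLaw P π x := by
    rw [h1, integral_sub (integrable_marlLaw P π x t G) (integrable_const _)]
    simp
  change |∫ ω, g (ω t) ∂marlLaw P π x - _| ≤ _
  rw [h2]
  refine abs_integral_le_integral_abs.trans ?_
  calc _ ≤ ∫ ω, (Lr * (√(Fintype.card U) / √N) +
          (Lr * (2 + L) + R * (1 + L)) * l1dist (empirical (ω t).1) m) ∂marlLaw P π x := by
        refine integral_mono
          (integrable_marlLaw P π x t fun z => |G z - meanReward r m (π t m)|)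
          (integrable_marlLaw P π x t fun z => Lr * (√(Fintype.card U) / √N) +
            (Lr * (2 + L) + R * (1 + L)) * l1dist (empirical z.1) m) fun ω => ?_
        refine (abs_sub_le _ (meanReward r (empirical (ω t).1) (π t (empirical (ω t).1))) _).trans
          (add_le_add ?_ ?_)
        · exact abs_integral_averageReward_sub_meanReward_le hLr hr (ω t).1 _
        · exact abs_meanReward_sub_le hLr hR hr _ _ _ _ fun a => hπ t a _ _
    _ = _ := by
        rw [integral_add (integrable_const _) (integrable_marlLaw P π x t fun z =>
          (Lr * (2 + L) + R * (1 + L)) * l1dist (empirical z.1) m)]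
        simp [stateGap, hm, integral_const_mul]

/-- The constant of the mean-field approximation. -/
def approxConst (γ R Lr LP L : ℝ) : ℝ :=
  Lr / (1 - γ) + (Lr * (2 + L) + R * (1 + L)) * (2 + LP) /
    (((2 * LP + 1) * (1 + L) - 1) * (1 - γ * ((2 * LP + 1) * (1 + L))))

theorem approxConst_nonneg {γ R Lr LP L : ℝ} (hγ1 : γ < 1) (hR : 0 ≤ R) (hLr : 0 ≤ Lr)
    (hLP : 0 ≤ LP) (hL : 0 ≤ L) (hcontr : γ * (2 * LP + 1) * (1 + L) < 1) :
    0 ≤ approxConst γ R Lr LP L := by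
  have h1 : 0 ≤ (2 * LP + 1) * (1 + L) - 1 := by
    have := mul_nonneg hLP hL
    linarith
  have h2 : 0 ≤ 1 - γ * ((2 * LP + 1) * (1 + L)) := by linarith
  have h3 : 0 ≤ 1 - γ := by linarith
  unfold approxConst
  positivity

theorem abs_marlValue_sub_mfcValue_le {γ R Lr LP L : ℝ} (hγ0 : 0 ≤ γ) (hγ1 : γ < 1) (hR : 0 ≤ R)
    (hLr : 0 ≤ Lr) (hLP : 0 < LP) (hL : 0 ≤ L) (hcontr : γ * (2 * LP + 1) * (1 + L) < 1)
    {r : Reward X U} {P : Transition X U} {π : Policy X U} (hr : r.Regular R Lr)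
    (hP : P.LipschitzBound LP) (hπ : π.LipschitzBound L) (x : Fin N → X) :
    |marlValue γ r P π x - mfcValue γ r P π (empirical x)| ≤
      approxConst γ R Lr LP L * (√(Fintype.card X) + √(Fintype.card U)) / √N := by
  have hdiff := (hasSum_marlValue hγ0 hγ1 hr P π x).sub
    (hasSum_mfcValue hγ0 hγ1 hr P π (empirical x))
  have hrew := abs_integral_averageReward_sub_le (P := P) hR hLr hr hπ x
  have hgap := stateGap_le hLP hL hP hπ x
  unfold approxConst
  set a := √(Fintype.card X : ℝ) with ha
  set b := √(Fintype.card U : ℝ) with hb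
  set S := (2 * LP + 1) * (1 + L) with hS
  set T := Lr * (2 + L) + R * (1 + L) with hT
  have hT0 : 0 ≤ T := by positivity
  have hS1 : 0 < S - 1 := by
    have := mul_nonneg hLP.le hL
    linarith
  have hγS : γ * S < 1 := by linarith
  have hγS0 : 0 ≤ γ * S := mul_nonneg hγ0 (by linarith)
  have hsum : HasSum (fun t => γ ^ t * (Lr * (b / √N)) +
      (γ * S) ^ t * (T * ((2 * a + LP * b) / √N / (S - 1))))
      ((1 - γ)⁻¹ * (Lr * (b / √N)) +
        (1 - γ * S)⁻¹ * (T * ((2 * a + LP * b) / √N / (S - 1)))) :=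
    ((hasSum_geometric_of_lt_one hγ0 hγ1).mul_right _).add
      ((hasSum_geometric_of_lt_one hγS0 hγS).mul_right _)
  rw [← hdiff.tsum_eq, ← Real.norm_eq_abs]
  refine (tsum_of_norm_bounded hsum fun t => ?_).trans ?_
  · rw [Real.norm_eq_abs, ← mul_sub, abs_mul, abs_of_nonneg (pow_nonneg hγ0 t), mul_pow]
    calc _ ≤ γ ^ t * (Lr * (b / √N) + T * ((2 * a + LP * b) / √N / (S - 1) * S ^ t)) := by
          refine mul_le_mul_of_nonneg_left ((hrew t).trans ?_) (pow_nonneg hγ0 t)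
          gcongr
          exact hgap t
      _ = _ := by ring
  · have h1 : 0 < 1 - γ := by linarith
    have h2 : 0 < 1 - γ * S := by linarith
    have ha0 : 0 ≤ a := Real.sqrt_nonneg _
    have hb0 : 0 ≤ b := Real.sqrt_nonneg _
    calc _ = (Lr / (1 - γ) * b + T / ((S - 1) * (1 - γ * S)) * (2 * a + LP * b)) / √N := by
          field_simp
      _ ≤ (Lr / (1 - γ) * (a + b) + T / ((S - 1) * (1 - γ * S)) * ((2 + LP) * (a + b))) / √N := by
          gcongr
          · linarith
          · nlinarith [mul_nonneg hLP.le ha0]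
      _ = _ := by ring

end Approximation

end MeanField

end

open MeanField in
theorem mainTheorem1 (γ R Lr LP LPol : ℝ) (hγ0 : 0 < γ) (hγ1 : γ < 1) (hR : 0 < R)
    (hLr : 0 < Lr) (hLP : 0 < LP) (hLPol : 0 < LPol)
    (hcontr : γ * (2 * LP + 1) * (1 + LPol) < 1) :
    ∃ K : ℝ, 0 ≤ K ∧
      ∀ (X U : Type*) [Fintype X] [Fintype U]
        [MeasurableSpace X] [DiscreteMeasurableSpace X]
        [MeasurableSpace U] [DiscreteMeasurableSpace U]
        (r : Reward X U) (P : Transition X U) (Pol : Set (Policy X U)),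
        r.Regular R Lr → P.LipschitzBound LP →
        (∀ π ∈ Pol, π.Admissible ∧ π.LipschitzBound LPol) →
        (∀ (N : ℕ) [NeZero N] (x : Fin N → X), ∀ π ∈ Pol,
          |marlValue γ r P π x - mfcValue γ r P π (empirical x)| ≤
            K * (√(Fintype.card X) + √(Fintype.card U)) / √N) ∧
        (∀ ε₁ : ℝ, 0 < ε₁ → ∃ D : ℕ, ∀ (N : ℕ) [NeZero N], D ≤ N →
          ∀ (x : Fin N → X) (ε₂ : ℝ), 0 ≤ ε₂ → ∀ π : Policy X U,
            IsEpsOptimal γ r P Pol ε₂ π (empirical x) →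
              IsEpsPareto γ r P Pol (ε₁ + ε₂) π x) := by
  have hK := approxConst_nonneg hγ1 hR.le hLr.le hLP.le hLPol.le hcontr
  refine ⟨approxConst γ R Lr LP LPol, hK, ?_⟩
  intro X U _ _ _ _ _ _ r P Pol hr hP hPol
  have hmain : ∀ (N : ℕ) [NeZero N] (x : Fin N → X), ∀ π ∈ Pol,
      |marlValue γ r P π x - mfcValue γ r P π (empirical x)| ≤
        approxConst γ R Lr LP LPol * (√(Fintype.card X) + √(Fintype.card U)) / √N :=
    fun N _ x π hπ => abs_marlValue_sub_mfcValue_le hγ0.le hγ1 hR.le hLr.le hLP hLPol.le hcontr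
      hr hP (hPol π hπ).2 x
  refine ⟨hmain, fun ε₁ hε₁ => ?_⟩
  set C := approxConst γ R Lr LP LPol * (√(Fintype.card X) + √(Fintype.card U)) with hC
  have hC0 : 0 ≤ C := by positivity
  refine ⟨⌈(2 * C / ε₁) ^ 2⌉₊, fun N _ hN x ε₂ _ π hπ => ⟨hπ.1, fun π' hπ' => ?_⟩⟩
  have hN0 : (0 : ℝ) < N := by exact_mod_cast Nat.pos_of_ne_zero (NeZero.ne N)
  have hbound : C / √N ≤ ε₁ / 2 := by
    have h1 : 2 * C / ε₁ ≤ √N := Real.le_sqrt_of_sq_le (Nat.ceil_le.1 hN)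
    rw [div_le_iff₀ hε₁] at h1
    rw [div_le_iff₀ (Real.sqrt_pos.2 hN0)]
    linarith
  have h1 := abs_le.1 ((hmain N x π hπ.1).trans hbound)
  have h2 := abs_le.1 ((hmain N x π' hπ').trans hbound)
  have h3 := hπ.2 π' hπ'
  linarith [h1.1, h2.2]
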